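/- Let $\Bbbk$ be a field of characteristic $0$, let $V=\Bbbk^5$ with coordinate ring $\Bbbk[V]=\Bbbk[x,s,t,u,v]$, graded by $\deg x=1$, $\deg s=\deg t=\deg u=3$, $\deg v=2$, and let $D$ be the locally nilpotent $\Bbbk$-derivation $$D=x^3\frac{\partial}{\partial s}+s\frac{\partial}{\partial t}+t\frac{\partial}{\partial u}+x^2\frac{\partial}{\partial v}$$ of $\Bbbk[V]$ (Daigle–Freudenburg). Let the additive group $\mathbb{G}_a=(\Bbbk,+)$ act on $\Bbbk[V]$ by $$(-a)\cdot f=\sum_{n\ge 0}\frac{D^n(f)}{n!}\,a^n\qquad(a\in\Bbbk,\ f\in\Bbbk[V]),$$ and let $\Bbbk[V]^{\mathbb{G}_a}$ be the ring of invariants. Put $$f_1=x,\qquad f_2=2x^3t-s^2,\qquad f_3=3x^6u-3x^3ts+s^3,$$ $$f_4=xv-s,\qquad f_5=x^2ts-s^2v+2x^3tv-3x^5u,$$ $$f_6=-18x^3tsu+9x^6u^2+8x^3t^3+6s^3u-3t^2s^2.$$ Then $f_1,\dots,f_6$ are homogeneous with respect to the above grading, they are invariant under $\mathbb{G}_a$,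 and $E=\{f_1,\dots,f_6\}$ is a separating set in $\Bbbk[V]^{\mathbb{G}_a}$: if two points $p,q\in V$ satisfy $f_i(p)=f_i(q)$ for $i=1,\dots,6$, then $f(p)=f(q)$ for every $f\in\Bbbk[V]^{\mathbb{G}_a}$. Moreover, the $\Bbbk$-algebra $\Bbbk[V]^{\mathbb{G}_a}$ is not finitely generated. -/

import Mathlib

namespace DaigleFreudenburg

open MvPolynomial

noncomputable section

variable (k : Type*) [Field k]

/-- The coordinate ring `k[V] = k[x, s, t, u, v]` of `V = k⁵`. The variables `x, s, t, u, v` are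
`X 0, X 1, X 2, X 3, X 4`, and a point of `V` is a map `Fin 5 → k`. -/
abbrev CoordRing : Type _ := MvPolynomial (Fin 5) k

/-- The derivation `D = x³ ∂/∂s + s ∂/∂t + t ∂/∂u + x² ∂/∂v` of `k[x, s, t, u, v]`. -/
def D : Derivation k (CoordRing k) (CoordRing k) :=
  (X 0 ^ 3 : CoordRing k) • pderiv 1 + (X 1 : CoordRing k) • pderiv 2 +
    (X 2 : CoordRing k) • pderiv 3 + (X 0 ^ 2 : CoordRing k) • pderiv 4

/-- `μ(f) = ∑ₙ (Dⁿ(f) / n!) rⁿ`, a polynomial in `r` with coefficients in `k[V]`. The sum is finite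
since `D` is locally nilpotent (see `exists_iterate_eq_zero` and `mu_coeff`). -/
def mu (f : CoordRing k) : Polynomial (CoordRing k) :=
  ∑ᶠ n : ℕ, Polynomial.monomial n ((n.factorial : k)⁻¹ • (D k)^[n] f)

/-- `μ_a(f)`, the value of `μ(f)` at `r = a`, for `a ∈ k`. -/
def muAt (a : k) (f : CoordRing k) : CoordRing k :=
  (mu k f).eval (C a)

variable {k}

lemma D_X0 : D k (X 0) = 0 := by simp [D, pderiv_X]
lemma D_X1 : D k (X 1) = X 0 ^ 3 := by simp [D, pderiv_X]
lemma D_X2 : D k (X 2) = X 1 := by simp [D, pderiv_X]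
lemma D_X3 : D k (X 3) = X 2 := by simp [D, pderiv_X]
lemma D_X4 : D k (X 4) = X 0 ^ 2 := by simp [D, pderiv_X]
lemma D_X0_pow (n : ℕ) : D k (X 0 ^ n) = 0 := by simp [D_X0]

lemma iterate_eq_zero_of_le {f : CoordRing k} {m n : ℕ} (h : (D k)^[m] f = 0) (hmn : m ≤ n) :
    (D k)^[n] f = 0 := by
  obtain ⟨j, rfl⟩ := Nat.exists_eq_add_of_le' hmn
  rw [Function.iterate_add_apply, h, iterate_map_zero]

lemma iterate_add' (n : ℕ) (f g : CoordRing k) :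
    (D k)^[n] (f + g) = (D k)^[n] f + (D k)^[n] g := by
  induction n with
  | zero => rfl
  | succ n ih => simp only [Function.iterate_succ_apply', ih, map_add]

lemma iterate_mul' (n : ℕ) (f g : CoordRing k) :
    (D k)^[n] (f * g) =
      ∑ ij ∈ Finset.HasAntidiagonal.antidiagonal n, n.choose ij.1 • ((D k)^[ij.1] f * (D k)^[ij.2] g) := by
  induction n with
  | zero => simp
  | succ n ih =>
    rw [Finset.sum_antidiagonal_choose_succ_nsmul (M := CoordRing k)
      (fun i j => (D k)^[i] f * (D k)^[j] g) n]
    rw [Function.iterate_succ_apply', ih, map_sum, ← Finset.sum_add_distrib]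
    refine Finset.sum_congr rfl fun ij hij => ?_
    rw [Finset.HasAntidiagonal.mem_antidiagonal] at hij
    have hc : n.choose ij.2 = n.choose ij.1 := by
      rw [← hij]; exact Nat.choose_symm_add.symm
    rw [map_nsmul, Derivation.leibniz, hc, smul_add, Function.iterate_succ_apply',
      Function.iterate_succ_apply', smul_eq_mul, smul_eq_mul, mul_comm ((D k)^[ij.2] g)]

/-- `D` is locally nilpotent. -/
lemma exists_iterate_eq_zero (f : CoordRing k) : ∃ n, (D k)^[n] f = 0 := by
  induction f using MvPolynomial.induction_on with
  | C a => exact ⟨1, by simp [MvPolynomial.derivation_C]⟩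
  | add f g hf hg =>
    obtain ⟨m, hm⟩ := hf
    obtain ⟨n, hn⟩ := hg
    refine ⟨m + n, ?_⟩
    rw [iterate_add', iterate_eq_zero_of_le hm (by omega), iterate_eq_zero_of_le hn (by omega),
      add_zero]
  | mul_X f i hf =>
    obtain ⟨m, hm⟩ := hf
    have hn : (D k)^[4] (X i) = 0 := by
      rw [Function.iterate_succ_apply', Function.iterate_succ_apply', Function.iterate_succ_apply',
        Function.iterate_one]
      fin_cases i
      · simp only [Fin.zero_eta, D_X0, map_zero]
      · simp only [Fin.mk_one, D_X1, D_X0_pow, map_zero]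
      · simp only [Fin.reduceFinMk, D_X2, D_X1, D_X0_pow, map_zero]
      · simp only [Fin.reduceFinMk, D_X3, D_X2, D_X1, D_X0_pow]
      · simp only [Fin.reduceFinMk, D_X4, D_X0_pow, map_zero]
    refine ⟨m + 4, ?_⟩
    rw [iterate_mul']
    refine Finset.sum_eq_zero fun ij hij => ?_
    rw [Finset.HasAntidiagonal.mem_antidiagonal] at hij
    rcases le_or_gt m ij.1 with h | h
    · rw [iterate_eq_zero_of_le hm h, zero_mul, smul_zero]
    · rw [iterate_eq_zero_of_le hn (by omega), mul_zero, smul_zero]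

lemma mu_eq_sum {f : CoordRing k} {N : ℕ} (h : (D k)^[N] f = 0) :
    mu k f = ∑ n ∈ Finset.range N,
      Polynomial.monomial n ((n.factorial : k)⁻¹ • (D k)^[n] f) := by
  refine finsum_eq_finsetSum_of_support_subset _ fun n hn => ?_
  by_contra hN
  refine hn ?_
  beta_reduce
  rw [iterate_eq_zero_of_le h (by simpa using hN), smul_zero, Polynomial.monomial_zero_right]

lemma mu_coeff (f : CoordRing k) (n : ℕ) :
    (mu k f).coeff n = (n.factorial : k)⁻¹ • (D k)^[n] f := by
  obtain ⟨N, hN⟩ := exists_iterate_eq_zero f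
  rw [mu_eq_sum (iterate_eq_zero_of_le hN (le_max_left N (n + 1))), Polynomial.finsetSum_coeff,
    Finset.sum_eq_single n]
  · simp
  · intro b _ hb
    rw [Polynomial.coeff_monomial, if_neg hb]
  · intro h
    exact absurd (Finset.mem_range.2 (by omega)) h

lemma mu_add (f g : CoordRing k) : mu k (f + g) = mu k f + mu k g := by
  ext1 n
  simp [mu_coeff, smul_add]

lemma mu_C (c : k) : mu k (C c) = Polynomial.C (C c) := by
  rw [mu_eq_sum (N := 1) (by simp [MvPolynomial.derivation_C])]
  simp

lemma mu_mul [CharZero k] (f g : CoordRing k) : mu k (f * g) = mu k f * mu k g := by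
  ext1 n
  rw [Polynomial.coeff_mul, mu_coeff, iterate_mul', Finset.smul_sum]
  refine Finset.sum_congr rfl fun ij hij => ?_
  rw [Finset.HasAntidiagonal.mem_antidiagonal] at hij
  rw [mu_coeff, mu_coeff, smul_mul_smul_comm, ← Nat.cast_smul_eq_nsmul k, smul_smul]
  congr 1
  have h := Nat.add_choose_mul_factorial_mul_factorial ij.1 ij.2
  rw [← Nat.choose_symm_add, hij] at h
  have h' : (n.choose ij.1 : k) * ij.1.factorial * ij.2.factorial = n.factorial := by
    exact_mod_cast h
  have h1 : (ij.1.factorial : k) ≠ 0 := Nat.cast_ne_zero.2 (Nat.factorial_ne_zero _)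
  have h2 : (ij.2.factorial : k) ≠ 0 := Nat.cast_ne_zero.2 (Nat.factorial_ne_zero _)
  have h3 : (n.factorial : k) ≠ 0 := Nat.cast_ne_zero.2 (Nat.factorial_ne_zero _)
  field_simp
  rw [← h']

variable (k) in
/-- `μ_a` as a homomorphism of `k`-algebras. -/
def muHom [CharZero k] (a : k) : CoordRing k →ₐ[k] CoordRing k where
  toFun := muAt k a
  map_one' := by rw [muAt, ← C_1, mu_C, Polynomial.eval_C]
  map_mul' f g := by rw [muAt, mu_mul, Polynomial.eval_mul]; rfl
  map_zero' := by rw [muAt, ← C_0, mu_C, Polynomial.eval_C]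
  map_add' f g := by rw [muAt, mu_add, Polynomial.eval_add]; rfl
  commutes' c := by rw [MvPolynomial.algebraMap_eq, muAt, mu_C, Polynomial.eval_C]

section
variable [CharZero k] (a : k)

lemma muHom_X0 : muHom k a (X 0) = X 0 := by
  change (mu k _).eval (C a) = _
  rw [mu_eq_sum (N := 1) (by simp [D_X0])]
  simp

lemma muHom_X1 : muHom k a (X 1) = X 1 + C a * X 0 ^ 3 := by
  change (mu k _).eval (C a) = _
  rw [mu_eq_sum (N := 2) (by simp [D_X0, D_X1])]
  simp [Finset.sum_range_succ, D_X1, mul_comm]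

lemma muHom_X2 : muHom k a (X 2) = X 2 + C a * X 1 + C (a ^ 2 / 2) * X 0 ^ 3 := by
  change (mu k _).eval (C a) = _
  rw [mu_eq_sum (N := 3) (by simp [D_X0, D_X1, D_X2])]
  simp [Finset.sum_range_succ, D_X1, D_X2, Nat.factorial, MvPolynomial.smul_eq_C_mul,
    div_eq_mul_inv, -map_inv₀]
  ring

lemma muHom_X3 : muHom k a (X 3) =
    X 3 + C a * X 2 + C (a ^ 2 / 2) * X 1 + C (a ^ 3 / 6) * X 0 ^ 3 := by
  have e1 : (D k)^[1] (X 3) = X 2 := D_X3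
  have e2 : (D k)^[2] (X 3) = X 1 := by rw [Function.iterate_succ_apply', e1, D_X2]
  have e3 : (D k)^[3] (X 3) = X 0 ^ 3 := by rw [Function.iterate_succ_apply', e2, D_X1]
  have e4 : (D k)^[4] (X 3) = 0 := by rw [Function.iterate_succ_apply', e3, D_X0_pow]
  have n2 : Nat.factorial 2 = 2 := rfl
  have n3 : Nat.factorial 3 = 6 := rfl
  change (mu k _).eval (C a) = _
  rw [mu_eq_sum e4]
  simp only [Finset.sum_range_succ, Finset.sum_range_zero, e1, e2, e3, n2, n3,
    Function.iterate_zero_apply, Nat.factorial_zero, Nat.factorial_one, Polynomial.eval_add,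
    Polynomial.eval_monomial, MvPolynomial.smul_eq_C_mul, Polynomial.eval_zero]
  simp only [div_eq_mul_inv, C_mul, C_pow, Nat.cast_one, inv_one, C_1, Nat.cast_ofNat]
  ring

lemma muHom_X4 : muHom k a (X 4) = X 4 + C a * X 0 ^ 2 := by
  change (mu k _).eval (C a) = _
  rw [mu_eq_sum (N := 2) (by simp [D_X0, D_X4])]
  simp [Finset.sum_range_succ, D_X4, mul_comm]

end

lemma muHom_zero [CharZero k] : muHom k 0 = AlgHom.id k (CoordRing k) := by
  refine MvPolynomial.algHom_ext fun i => ?_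
  fin_cases i <;> simp [muHom_X0, muHom_X1, muHom_X2, muHom_X3, muHom_X4]

lemma muHom_add [CharZero k] (a b : k) : muHom k (a + b) = (muHom k a).comp (muHom k b) := by
  have hC : ∀ c : k, muHom k a (C c) = C c := fun c => (muHom k a).commutes c
  refine MvPolynomial.algHom_ext fun i => ?_
  fin_cases i
  · simp [muHom_X0]
  · simp [muHom_X0, muHom_X1, hC]; ring
  · simp only [Fin.reduceFinMk, AlgHom.comp_apply, muHom_X2, map_add, map_mul, map_pow, hC,
      muHom_X1, muHom_X0]
    have : C ((a + b) ^ 2 / 2) = (C (a ^ 2 / 2) + C a * C b + C (b ^ 2 / 2) : CoordRing k) := by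
      simp only [← C_mul, ← C_add]; congr 1; field_simp; ring
    rw [this]; ring
  · simp only [Fin.reduceFinMk, AlgHom.comp_apply, muHom_X3, map_add, map_mul, map_pow, hC,
      muHom_X2, muHom_X1, muHom_X0]
    have h2 : C ((a + b) ^ 2 / 2) = (C (a ^ 2 / 2) + C a * C b + C (b ^ 2 / 2) : CoordRing k) := by
      simp only [← C_mul, ← C_add]; congr 1; field_simp; ring
    have h3 : C ((a + b) ^ 3 / 6) = (C (a ^ 3 / 6) + C (a ^ 2 / 2) * C b + C a * C (b ^ 2 / 2) +
        C (b ^ 3 / 6) : CoordRing k) := by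
      simp only [← C_mul, ← C_add]; congr 1; field_simp; ring
    rw [h2, h3]; ring
  · simp [muHom_X0, muHom_X4, hC]; ring

variable (k) in
/-- The induced action of the additive group `𝔾ₐ = (k, +)` on `k[V]` by `k`-algebra endomorphisms:
`(-a) · f = μ_a(f)`, that is, `a · f = μ_{-a}(f)`. -/
def gaAction [CharZero k] : Multiplicative k →* (CoordRing k →ₐ[k] CoordRing k) where
  toFun a := muHom k (-a.toAdd)
  map_one' := by rw [toAdd_one, neg_zero, muHom_zero]; rfl
  map_mul' a b := by rw [toAdd_mul, neg_add, muHom_add]; rfl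

variable (k) in
/-- The ring of invariants `k[V]^𝔾ₐ`. -/
def invariantRing [CharZero k] : Subalgebra k (CoordRing k) where
  carrier := {f | ∀ a : k, gaAction k (Multiplicative.ofAdd a) f = f}
  mul_mem' hf hg a := by rw [map_mul, hf a, hg a]
  add_mem' hf hg a := by rw [map_add, hf a, hg a]
  algebraMap_mem' c a := AlgHom.commutes _ c

/-- The grading of `k[V]`: `deg x = 1`, `deg s = deg t = deg u = 3`, `deg v = 2`. -/
def weight : Fin 5 → ℕ := ![1, 3, 3, 3, 2]

/-- `E` is a separating set in the algebra of invariants `A ⊆ k[V]`: it consists of elements of `A`,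
and any two points of `V` with equal values under all members of `E` have equal values under all
members of `A`. -/
def IsSeparatingSet (A : Subalgebra k (CoordRing k)) (E : Set (CoordRing k)) : Prop :=
  E ⊆ A ∧ ∀ p q : Fin 5 → k, (∀ f ∈ E, eval p f = eval q f) → ∀ f ∈ A, eval p f = eval q f

variable (k) in
/-- `f₁ = x`. -/
def f₁ : CoordRing k := X 0

variable (k) in
/-- `f₂ = 2x³t - s²`. -/
def f₂ : CoordRing k := 2 * X 0 ^ 3 * X 2 - X 1 ^ 2

variable (k) in
/-- `f₃ = 3x⁶u - 3x³ts + s³`. -/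
def f₃ : CoordRing k := 3 * X 0 ^ 6 * X 3 - 3 * X 0 ^ 3 * X 2 * X 1 + X 1 ^ 3

variable (k) in
/-- `f₄ = xv - s`. -/
def f₄ : CoordRing k := X 0 * X 4 - X 1

variable (k) in
/-- `f₅ = x²ts - s²v + 2x³tv - 3x⁵u`. -/
def f₅ : CoordRing k :=
  X 0 ^ 2 * X 2 * X 1 - X 1 ^ 2 * X 4 + 2 * X 0 ^ 3 * X 2 * X 4 - 3 * X 0 ^ 5 * X 3

variable (k) in
/-- `f₆ = -18x³tsu + 9x⁶u² + 8x³t³ + 6s³u - 3t²s²`. -/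
def f₆ : CoordRing k :=
  -18 * X 0 ^ 3 * X 2 * X 1 * X 3 + 9 * X 0 ^ 6 * X 3 ^ 2 + 8 * X 0 ^ 3 * X 2 ^ 3 +
    6 * X 1 ^ 3 * X 3 - 3 * X 2 ^ 2 * X 1 ^ 2

variable (k) in
/-- The set `E = {f₁, f₂, f₃, f₄, f₅, f₆}`. -/
def separatingSet : Set (CoordRing k) := {f₁ k, f₂ k, f₃ k, f₄ k, f₅ k, f₆ k}

end

end DaigleFreudenburg

/-! In characteristic `0` the invariants are the kernel of `D` (`mem_invariantRing_iff_D_eq_zero`).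

Separation. Where `x ≠ 0`, or `x = 0` and `s ≠ 0`, two points with equal values of the `fᵢ` lie in
one orbit, the translation parameter being read off from `s` or from `t`. On `x = s = 0` every
invariant is constant (`eval_null`). There `t` and `u` are removed by taking limits of pairs of
curves lying in the same orbits (`eval_null_reflect`), and `v` by dividing `D f = 0` by `x²`
(`restrictV_pderiv_eq_zero`).

Infinite generation. Let `L` be the line `x = s = t = u = 0`. Since invariants are constant on `L`,
`f ↦ ∂f/∂x` restricted to `L` obeys a Leibniz rule with scalar coefficients on invariants, so
finitely many generators would bound its degree in `v`. A sequence `h₀ = x`, `D hₙ₊₁ = x² hₙ` gives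
the invariants `∑ (-1)ⁱ hᵢ vʲ / j!` over `i + j = n`, for which this degree is unbounded. The
sequence exists by `sl₂`-theory: with `y = x³`, `D` acts on `k[y, s, t, u]` as the raising operator
on binary cubics, and raising operators are onto positive weights (`exists_apply_eq_of_weight_pos`).
-/

namespace DaigleFreudenburg

open MvPolynomial

/-! ### Surjectivity of the raising operator onto positive weights -/

section Sl2

variable {k M : Type*} [Field k] [CharZero k] [AddCommGroup M] [Module k M]

/-- For an `sl₂`-triple `(D, H, U)` on `M` and `w` of weight `m`,
`D^(r+1) U w = U D^(r+1) w + (r+1)(m+r) D^r w`. -/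
lemma iterate_succ_comm_apply (D U H : Module.End k M)
    (hDU : ∀ w, D (U w) = U (D w) + H w) (hHD : ∀ w, H (D w) = D (H w) + (2 : k) • D w)
    {m : k} {w : M} (hw : H w = m • w) (r : ℕ) :
    (D ^ (r + 1)) (U w) = U ((D ^ (r + 1)) w) + (((r : k) + 1) * (m + r)) • (D ^ r) w := by
  have hH : ∀ r : ℕ, H ((D ^ r) w) = (m + 2 * r) • (D ^ r) w := by
    intro r
    induction r with
    | zero => simp [hw]
    | succ r ih =>
      rw [pow_succ', Module.End.mul_apply, hHD, ih, map_smul, ← add_smul]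
      push_cast
      congr 1
      ring
  induction r with
  | zero => simp [hDU, hw]
  | succ r ih =>
    have hD : ∀ r : ℕ, (D ^ (r + 1)) w = D ((D ^ r) w) := fun r => by
      rw [pow_succ', Module.End.mul_apply]
    rw [pow_succ', Module.End.mul_apply, Module.End.mul_apply, ih, map_add, hDU, map_smul, hH,
      ← hD r,
      add_assoc, ← add_smul]
    congr 2
    push_cast
    ring

/-- For an `sl₂`-triple `(D, H, U)`, the operator `D` maps the weight space `m - 2` onto the
`D`-nilpotent part of the weight space `m`, for every positive integer `m`. -/
lemma exists_apply_eq_of_weight_pos (D U H : Module.End k M)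
    (hDU : ∀ w, D (U w) = U (D w) + H w) (hHD : ∀ w, H (D w) = D (H w) + (2 : k) • D w)
    (hHU : ∀ w, H (U w) = U (H w) - (2 : k) • U w)
    {m : ℕ} (hm : 0 < m) (j : ℕ) {w : M} (hw : H w = (m : k) • w) (hj : (D ^ j) w = 0) :
    ∃ w', D w' = w ∧ H w' = ((m : k) - 2) • w' := by
  induction j generalizing w with
  | zero => exact ⟨0, by simpa using hj.symm, by simp⟩
  | succ j ih =>
    have hc : (((j : k) + 1) * (m + j)) ≠ 0 := by
      have : ((j + 1) * (m + j) : ℕ) ≠ 0 := by positivity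
      exact_mod_cast this
    set c : k := ((j : k) + 1) * (m + j)
    have hU : H (U w) = ((m : k) - 2) • U w := by rw [hHU, hw, map_smul, sub_smul]
    have hDUw : H (D (U w)) = (m : k) • D (U w) := by
      rw [hHD, hU, map_smul, ← add_smul, sub_add_cancel]
    -- As `D^(j+1) w = 0`, the commutation formula gives `D^j (D (U w)) = c • D^j w`, so the
    -- corrected vector is killed by `D^j`.
    obtain ⟨w', h1, h2⟩ := ih (w := w - c⁻¹ • D (U w))
      (by rw [map_sub, map_smul, hDUw, hw, smul_sub, smul_comm c⁻¹])
      (by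
        have h := iterate_succ_comm_apply D U H hDU hHD hw j
        rw [hj, map_zero, zero_add] at h
        rw [map_sub, map_smul, ← Module.End.mul_apply, ← pow_succ, h, smul_smul,
          inv_mul_cancel₀ hc, one_smul, sub_self])
    refine ⟨w' + c⁻¹ • U w, ?_, ?_⟩
    · rw [map_add, map_smul, h1, sub_add_cancel]
    · rw [map_add, map_smul, h2, hU, smul_add, smul_comm c⁻¹]

end Sl2

noncomputable section

variable {k : Type*} [Field k]

/-! ### The `sl₂`-action on `k[y, s, t, u]` -/

section Cubic

variable (k) in
/-- The operator `y ∂/∂s + s ∂/∂t + t ∂/∂u` on `k[y, s, t, u]`. -/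
def cubicD : Derivation k (MvPolynomial (Fin 4) k) (MvPolynomial (Fin 4) k) :=
  mkDerivation k ![0, X 0, X 1, X 2]

variable (k) in
/-- The operator `3s ∂/∂y + 4t ∂/∂s + 3u ∂/∂t` on `k[y, s, t, u]`. -/
def cubicU : Derivation k (MvPolynomial (Fin 4) k) (MvPolynomial (Fin 4) k) :=
  mkDerivation k ![(3 : k) • X 1, (4 : k) • X 2, (3 : k) • X 3, 0]

variable (k) in
/-- The weight operator `3y ∂/∂y + s ∂/∂s - t ∂/∂t - 3u ∂/∂u` on `k[y, s, t, u]`. -/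
def cubicH : Derivation k (MvPolynomial (Fin 4) k) (MvPolynomial (Fin 4) k) :=
  mkDerivation k ![(3 : k) • X 0, X 1, -X 2, -((3 : k) • X 3)]

lemma cubicD_cubicU (w : MvPolynomial (Fin 4) k) :
    cubicD k (cubicU k w) = cubicU k (cubicD k w) + cubicH k w := by
  have h : ⁅cubicD k, cubicU k⁆ = cubicH k := by
    refine MvPolynomial.derivation_ext fun i => ?_
    fin_cases i <;> simp [Derivation.commutator_apply, cubicD, cubicU, cubicH, mkDerivation_X] <;> module
  rw [← h, Derivation.commutator_apply]
  ring

lemma cubicH_cubicD (w : MvPolynomial (Fin 4) k) :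
    cubicH k (cubicD k w) = cubicD k (cubicH k w) + (2 : k) • cubicD k w := by
  have h : ⁅cubicH k, cubicD k⁆ = (2 : k) • cubicD k := by
    refine MvPolynomial.derivation_ext fun i => ?_
    fin_cases i <;> simp [Derivation.commutator_apply, cubicD, cubicH, mkDerivation_X] <;> module
  rw [← Derivation.smul_apply, ← h, Derivation.commutator_apply]
  ring

lemma cubicH_cubicU (w : MvPolynomial (Fin 4) k) :
    cubicH k (cubicU k w) = cubicU k (cubicH k w) - (2 : k) • cubicU k w := by
  have h : ⁅cubicU k, cubicH k⁆ = (2 : k) • cubicU k := by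
    refine MvPolynomial.derivation_ext fun i => ?_
    fin_cases i <;> simp [Derivation.commutator_apply, cubicU, cubicH, mkDerivation_X] <;> module
  rw [← Derivation.smul_apply, ← h, Derivation.commutator_apply]
  ring

variable (k) in
/-- The embedding `k[y, s, t, u] → k[x, s, t, u, v]`, `y ↦ x³`. -/
def cubicMap : MvPolynomial (Fin 4) k →ₐ[k] CoordRing k :=
  aeval ![X 0 ^ 3, X 1, X 2, X 3]

lemma D_cubicMap (w : MvPolynomial (Fin 4) k) :
    D k (cubicMap k w) = cubicMap k (cubicD k w) := by
  induction w using MvPolynomial.induction_on with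
  | C a => simp [cubicMap, cubicD, MvPolynomial.algebraMap_eq]
  | add p q hp hq => simp [hp, hq]
  | mul_X p i hp =>
    have hi : D k (cubicMap k (X i)) = cubicMap k (cubicD k (X i)) := by
      fin_cases i <;> simp [cubicMap, cubicD, mkDerivation_X, D_X0, D_X1, D_X2, D_X3]
    simp only [map_mul, Derivation.leibniz, smul_eq_mul, hp, hi, map_add]

/-- Cubing `s, t, u` as well, while sending `x` to `y`, turns the map into the substitution of cubes
for all variables, which is injective. -/
lemma cubicMap_injective : Function.Injective (cubicMap k) := by
  have h : (aeval ![X 0, X 1 ^ 3, X 2 ^ 3, X 3 ^ 3, 0]).comp (cubicMap k) =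
      MvPolynomial.expand (σ := Fin 4) (R := k) 3 := by
    refine MvPolynomial.algHom_ext fun i => ?_
    fin_cases i <;> simp [cubicMap]
  have hinj := MvPolynomial.expand_injective (σ := Fin 4) (R := k) (n := 3) (by norm_num)
  rw [← h, AlgHom.coe_comp] at hinj
  exact hinj.of_comp

lemma D_iterate_cubicMap (n : ℕ) (w : MvPolynomial (Fin 4) k) :
    (D k)^[n] (cubicMap k w) = cubicMap k (((cubicD k).toLinearMap ^ n) w) := by
  induction n with
  | zero => rfl
  | succ n ih =>
    rw [Function.iterate_succ_apply', ih, D_cubicMap, pow_succ']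
    rfl

end Cubic

/-! ### The sequence `D hₙ₊₁ = x² hₙ` -/

section LadderSequence

/-- Elements `xᵉ φ(w)` of `k[x, s, t, u]` with `e ≤ 2` and `w` of weight `1 - e`. -/
def IsLadderElement (h : CoordRing k) : Prop :=
  ∃ (e : ℕ) (w : MvPolynomial (Fin 4) k), e ≤ 2 ∧ h = X 0 ^ e * cubicMap k w ∧
    cubicH k w = (1 - e : k) • w

lemma exists_cubicD_eq [CharZero k] {m : ℕ} (hm : 0 < m) {w : MvPolynomial (Fin 4) k}
    (hw : cubicH k w = (m : k) • w) :
    ∃ w', cubicD k w' = w ∧ cubicH k w' = ((m : k) - 2) • w' := by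
  obtain ⟨j, hj⟩ := exists_iterate_eq_zero (cubicMap k w)
  rw [D_iterate_cubicMap, ← map_zero (cubicMap k)] at hj
  exact exists_apply_eq_of_weight_pos (cubicD k).toLinearMap (cubicU k).toLinearMap
    (cubicH k).toLinearMap cubicD_cubicU cubicH_cubicD cubicH_cubicU hm j hw
    (cubicMap_injective hj)

lemma cubicH_X0_mul {m : k} {w : MvPolynomial (Fin 4) k} (hw : cubicH k w = m • w) :
    cubicH k (X 0 * w) = (m + 3) • (X 0 * w) := by
  have h0 : cubicH k (X 0) = (3 : k) • X 0 := by simp [cubicH, mkDerivation_X]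
  rw [Derivation.leibniz, hw, h0, smul_eq_mul, smul_eq_mul, mul_smul_comm, mul_smul_comm,
    mul_comm w, add_smul]

lemma cubicMap_X0_mul (w : MvPolynomial (Fin 4) k) :
    cubicMap k (X 0 * w) = X 0 ^ 3 * cubicMap k w := by
  simp [cubicMap]

lemma D_X0_pow_mul (e : ℕ) (f : CoordRing k) : D k (X 0 ^ e * f) = X 0 ^ e * D k f := by
  rw [Derivation.leibniz, D_X0_pow, smul_zero, add_zero, smul_eq_mul]

/-- Giving `x` weight `1`, ladder elements have total weight `1`. Rewrite `x² · xᵉ` as `x^e'` or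
`x^e' y` with `e' ≤ 2`: the cofactor of `x^e'` then has weight `3 - e' > 0`, so it is in the image
of `cubicD`, with a preimage of weight `1 - e'`. -/
lemma IsLadderElement.exists_D_eq [CharZero k] {h : CoordRing k} (hh : IsLadderElement h) :
    ∃ h', IsLadderElement h' ∧ D k h' = X 0 ^ 2 * h := by
  obtain ⟨e, w, he, rfl, hw⟩ := hh
  interval_cases e
  · obtain ⟨w', h1, h2⟩ := exists_cubicD_eq (m := 1) one_pos (w := w) (by simpa using hw)
    refine ⟨X 0 ^ 2 * cubicMap k w', ⟨2, w', le_rfl, rfl, ?_⟩, ?_⟩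
    · simpa using h2
    · rw [D_X0_pow_mul, D_cubicMap, h1, pow_zero, one_mul]
  · obtain ⟨w', h1, h2⟩ := exists_cubicD_eq (m := 3) three_pos (w := X 0 * w)
      (by simpa using cubicH_X0_mul hw)
    refine ⟨X 0 ^ 0 * cubicMap k w', ⟨0, w', by norm_num, rfl, ?_⟩, ?_⟩
    · rw [h2]; congr 1; norm_num
    · rw [D_X0_pow_mul, D_cubicMap, h1, cubicMap_X0_mul]; ring
  · obtain ⟨w', h1, h2⟩ := exists_cubicD_eq (m := 2) two_pos (w := X 0 * w)
      (by rw [cubicH_X0_mul hw]; congr 1; norm_num)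
    refine ⟨X 0 ^ 1 * cubicMap k w', ⟨1, w', by norm_num, rfl, ?_⟩, ?_⟩
    · rw [h2]; congr 1; norm_num
    · rw [D_X0_pow_mul, D_cubicMap, h1, cubicMap_X0_mul]; ring

variable (k) in
lemma exists_ladder [CharZero k] : ∃ h : ℕ → CoordRing k, h 0 = X 0 ∧
    (∀ n, D k (h (n + 1)) = X 0 ^ 2 * h n) ∧ ∀ n, IsLadderElement (h n) := by
  choose! g hg hD using fun (h : CoordRing k) (hh : IsLadderElement h) => hh.exists_D_eq
  have h0 : IsLadderElement (X 0 : CoordRing k) := ⟨1, 1, by norm_num, by simp, by simp⟩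
  have hmem : ∀ n : ℕ, IsLadderElement (g^[n] (X 0)) := by
    intro n
    induction n with
    | zero => exact h0
    | succ n ih => rw [Function.iterate_succ_apply']; exact hg _ ih
  exact ⟨fun n => g^[n] (X 0), rfl,
    fun n => by simp only [Function.iterate_succ_apply']; exact hD _ (hmem n), hmem⟩

end LadderSequence

/-! ### Invariants as the kernel of `D`, and limits of orbits -/

section Invariants

variable [CharZero k]

lemma mem_invariantRing_iff_D_eq_zero {f : CoordRing k} :
    f ∈ invariantRing k ↔ D k f = 0 := by
  constructor
  · intro hf
    have hmu : mu k f = Polynomial.C f := by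
      refine Polynomial.eq_of_infinite_eval_eq _ _ ?_
      refine (Set.infinite_range_of_injective (C_injective (Fin 5) k)).mono ?_
      rintro _ ⟨a, rfl⟩
      have := hf (-a)
      change muAt k (- -a) f = f at this
      rw [neg_neg] at this
      simpa [muAt] using this
    have := mu_coeff f 1
    rw [hmu] at this
    simpa [Polynomial.coeff_C] using this.symm
  · intro hf a
    change (mu k f).eval (C (-a)) = f
    rw [mu_eq_sum (N := 1) (by simpa using hf)]
    simp

/-- The action of `a ∈ 𝔾ₐ` on points. -/
def translate (a : k) (p : Fin 5 → k) : Fin 5 → k :=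
  ![p 0, p 1 + a * p 0 ^ 3, p 2 + a * p 1 + a ^ 2 / 2 * p 0 ^ 3,
    p 3 + a * p 2 + a ^ 2 / 2 * p 1 + a ^ 3 / 6 * p 0 ^ 3, p 4 + a * p 0 ^ 2]

lemma eval_muHom (a : k) (p : Fin 5 → k) (f : CoordRing k) :
    eval p (muHom k a f) = eval (translate a p) f := by
  have h : (aeval p).comp (muHom k a) = aeval (translate a p) := by
    refine MvPolynomial.algHom_ext fun i => ?_
    fin_cases i <;>
      simp [translate, muHom_X0, muHom_X1, muHom_X2, muHom_X3, muHom_X4]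
  simpa [aeval_eq_eval] using DFunLike.congr_fun h f

lemma eval_translate {f : CoordRing k} (hf : f ∈ invariantRing k) (a : k) (p : Fin 5 → k) :
    eval (translate a p) f = eval p f := by
  have := hf (-a)
  change muHom k (- -a) f = f at this
  rw [neg_neg] at this
  rw [← eval_muHom, this]

omit [CharZero k] in
lemma eval_aeval_polynomial (f : CoordRing k) (R : Fin 5 → Polynomial k) (δ : k) :
    (aeval R f).eval δ = eval (fun i => (R i).eval δ) f := by
  have : ((Polynomial.aeval δ).comp (aeval R) : CoordRing k →ₐ[k] k) =
      aeval (fun i => (R i).eval δ) := by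
    refine MvPolynomial.algHom_ext fun i => ?_
    simp [Polynomial.coe_aeval_eq_eval]
  simpa [aeval_eq_eval, Polynomial.coe_aeval_eq_eval] using DFunLike.congr_fun this f

/-- An invariant takes equal values at the limits of two curves that lie pairwise in the same
orbits. -/
lemma eval_curve_zero_eq {f : CoordRing k} (hf : f ∈ invariantRing k)
    (P Q : Fin 5 → Polynomial k)
    (h : ∀ δ : k, δ ≠ 0 → ∃ a : k,
      (fun i => (Q i).eval δ) = translate a (fun i => (P i).eval δ)) :
    eval (fun i => (Q i).eval 0) f = eval (fun i => (P i).eval 0) f := by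
  -- Both sides are polynomials in `δ` that agree at every `δ ≠ 0`, and `k` is infinite.
  have hPQ : aeval Q f = aeval P f := by
    refine Polynomial.eq_of_infinite_eval_eq _ _ ?_
    refine (Set.finite_singleton (0 : k)).infinite_compl.mono fun δ hδ => ?_
    obtain ⟨a, ha⟩ := h δ hδ
    rw [Set.mem_ofPred_eq, eval_aeval_polynomial, eval_aeval_polynomial, ha, eval_translate hf]
  rw [← eval_aeval_polynomial, ← eval_aeval_polynomial, hPQ]

/-- Translating a curve with `x = δ²` by `α / δ³` keeps every coordinate polynomial in `δ` once the
pole in the `u`-coordinate cancels. As `δ → 0` the two curves reach different points of the plane `x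
= s = 0`. -/
lemma eval_null_reflect {f : CoordRing k} (hf : f ∈ invariantRing k) {α : k} (hα : α ≠ 0)
    (t u u' v : k) :
    eval ![0, 0, α ^ 2 / 6 - t, u', v] f = eval ![0, 0, t, u, v] f := by
  -- This `σ` cancels the `δ⁻³` term of the translated `u`-coordinate; `τ` then makes its limit the
  -- prescribed `u'`.
  obtain ⟨σ, hσ⟩ : ∃ σ : k, t = -α * (σ / 2 + α / 6) :=
    ⟨-2 * (t / α + α / 6), by field_simp; ring⟩
  obtain ⟨τ, hτ⟩ : ∃ τ : k, u' = u + α * τ := ⟨(u' - u) / α, by field_simp; ring⟩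
  have h := eval_curve_zero_eq hf
    (![Polynomial.X ^ 2, Polynomial.C σ * Polynomial.X ^ 3,
      Polynomial.C t + Polynomial.C τ * Polynomial.X ^ 3, Polynomial.C u, Polynomial.C v])
    (![Polynomial.X ^ 2, Polynomial.C (σ + α) * Polynomial.X ^ 3,
      Polynomial.C (α ^ 2 / 6 - t) + Polynomial.C τ * Polynomial.X ^ 3, Polynomial.C u',
      Polynomial.C v + Polynomial.C α * Polynomial.X])
    (by
      intro δ hδ
      refine ⟨α / δ ^ 3, funext fun i => ?_⟩
      fin_cases i <;> simp [translate]
      · field_simp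
      · field_simp; rw [hσ]; field_simp; ring
      · rw [hτ, hσ]; field_simp; ring
      · field_simp)
  convert h using 2
  · congr 1; funext i; fin_cases i <;> simp
  · congr 1; funext i; fin_cases i <;> simp

lemma eval_null_eq {f : CoordRing k} (hf : f ∈ invariantRing k) (t u v : k) :
    eval ![0, 0, t, u, v] f = eval ![0, 0, 0, 0, v] f := by
  have hstep : ∀ t : k, eval ![0, 0, t + 1 / 2, 0, v] f = eval ![0, 0, t, 0, v] f := by
    intro t
    -- The reflections for `α = 1` and `α = 2` compose to the shift of `t` by `1 / 2`.
    rw [show t + 1 / 2 = 2 ^ 2 / 6 - (1 ^ 2 / 6 - t) by ring,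
      eval_null_reflect hf two_ne_zero _ 0, eval_null_reflect hf one_ne_zero _ 0]
  have hnat : ∀ n : ℕ, eval ![0, 0, (n : k) / 2, 0, v] f = eval ![0, 0, 0, 0, v] f := by
    intro n
    induction n with
    | zero => simp
    | succ n ih => rw [Nat.cast_succ, add_div, hstep, ih]
  have hconst : aeval ![0, 0, Polynomial.X, 0, Polynomial.C v] f =
      Polynomial.C (eval ![0, 0, 0, 0, v] f) := by
    refine Polynomial.eq_of_infinite_eval_eq _ _ ?_
    refine (Set.infinite_range_of_injective (f := fun n : ℕ => (n : k) / 2) ?_).mono ?_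
    · intro m n h
      simpa using h
    · rintro _ ⟨n, rfl⟩
      rw [Set.mem_ofPred_eq, eval_aeval_polynomial, Polynomial.eval_C, ← hnat n]
      congr 2
      funext i
      fin_cases i <;> simp
  -- One more reflection, with `α = 1`, trades an arbitrary `u` for `0`.
  have h := congrArg (Polynomial.eval (1 ^ 2 / 6 - t)) hconst
  rw [eval_aeval_polynomial, Polynomial.eval_C] at h
  rw [← h, ← eval_null_reflect hf one_ne_zero t u 0 v]
  congr 2
  funext i
  fin_cases i <;> simp

end Invariants

/-! ### Constancy of invariants on `x = s = 0` -/

section NullRestriction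

variable (k) in
/-- Restriction to the line `x = s = t = u = 0` with coordinate `v`. -/
def restrictV : CoordRing k →ₐ[k] Polynomial k :=
  aeval ![0, 0, 0, 0, Polynomial.X]

lemma derivative_restrictV (f : CoordRing k) :
    Polynomial.derivative (restrictV k f) = restrictV k (pderiv 4 f) := by
  induction f using MvPolynomial.induction_on with
  | C a => simp [restrictV]
  | add p q hp hq => simp [hp, hq]
  | mul_X p i hp =>
    have hi : Polynomial.derivative (restrictV k (X i)) = restrictV k (pderiv 4 (X i)) := by
      fin_cases i <;> simp [restrictV, pderiv_X]
    simp only [map_mul, Derivation.leibniz, smul_eq_mul, map_add, Polynomial.derivative_mul, hp,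
      hi]
    ring

/-- On `s = t = u = 0` the equation `D f = 0` reads `x² (x ∂f/∂s + ∂f/∂v) = 0`; cancel `x²`, then
set `x = 0`. -/
lemma restrictV_pderiv_eq_zero {f : CoordRing k} (hf : D k f = 0) :
    restrictV k (pderiv 4 f) = 0 := by
  set Ξ : CoordRing k →ₐ[k] Polynomial (Polynomial k) :=
    aeval ![Polynomial.X, 0, 0, 0, Polynomial.C Polynomial.X]
  have hΞ : ∀ g, (Ξ g).eval 0 = restrictV k g := by
    intro g
    have : ((Polynomial.aeval (0 : Polynomial k)).restrictScalars k).comp Ξ = restrictV k := by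
      refine MvPolynomial.algHom_ext fun i => ?_
      fin_cases i <;> simp [Ξ, restrictV]
    simpa [Polynomial.coe_aeval_eq_eval] using DFunLike.congr_fun this g
  have h0 : Ξ (D k f) = 0 := by rw [hf, map_zero]
  have hX : Polynomial.X ^ 2 * (Polynomial.X * Ξ (pderiv 1 f) + Ξ (pderiv 4 f)) = 0 := by
    rw [← h0]
    simp [D, Ξ]
    ring
  have h := (mul_eq_zero.1 hX).resolve_left (pow_ne_zero _ Polynomial.X_ne_zero)
  simpa [hΞ] using congrArg (Polynomial.eval 0) h

variable [CharZero k]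

lemma exists_restrictV_eq_C {f : CoordRing k} (hf : f ∈ invariantRing k) :
    ∃ c : k, restrictV k f = Polynomial.C c := by
  refine ⟨_, Polynomial.eq_C_of_derivative_eq_zero ?_⟩
  rw [derivative_restrictV, restrictV_pderiv_eq_zero (mem_invariantRing_iff_D_eq_zero.1 hf)]

lemma eval_null {f : CoordRing k} (hf : f ∈ invariantRing k) (t u v : k) :
    eval ![0, 0, t, u, v] f = eval 0 f := by
  obtain ⟨c, hc⟩ := exists_restrictV_eq_C hf
  have h : ∀ v : k, eval ![0, 0, 0, 0, v] f = c := by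
    intro v
    have := congrArg (Polynomial.eval v) hc
    rw [restrictV, eval_aeval_polynomial, Polynomial.eval_C] at this
    rw [← this]
    congr 2
    funext i
    fin_cases i <;> simp
  rw [eval_null_eq hf, h, ← h 0]
  congr 2
  funext i
  fin_cases i <;> rfl

end NullRestriction

/-! ### Homogeneity, invariance and separation -/

section Separating

lemma D_eq_zero_of_mem_separatingSet {f : CoordRing k} (hf : f ∈ separatingSet k) :
    D k f = 0 := by
  have hn : ∀ n : ℕ, D k (n : CoordRing k) = 0 := (D k).map_natCast
  have h2 := hn 2
  have h3 := hn 3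
  have h6 := hn 6
  have h8 := hn 8
  have h9 := hn 9
  have h18 := hn 18
  push_cast at h2 h3 h6 h8 h9 h18
  simp only [separatingSet, Set.mem_insert_iff, Set.mem_singleton_iff] at hf
  rcases hf with rfl | rfl | rfl | rfl | rfl | rfl <;>
    simp only [f₁, f₂, f₃, f₄, f₅, f₆, map_add, map_sub, map_neg, Derivation.leibniz,
      Derivation.leibniz_pow, smul_eq_mul, D_X0, D_X1, D_X2, D_X3, D_X4, h2, h3, h6, h8, h9,
      h18] <;>
    ring

lemma isWeightedHomogeneous_of_mem_separatingSet {f : CoordRing k} (hf : f ∈ separatingSet k) :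
    ∃ d : ℕ, IsWeightedHomogeneous weight f d := by
  have hX : ∀ (i : Fin 5) (n : ℕ),
      IsWeightedHomogeneous weight (X i ^ n : CoordRing k) (n * weight i) := fun i n => by
    simpa using (isWeightedHomogeneous_X k weight i).pow n
  have hC : ∀ c : ℤ, IsWeightedHomogeneous weight (c : CoordRing k) 0 := fun c => by
    simpa using isWeightedHomogeneous_C weight (c : k)
  have hm : ∀ (c : ℤ) (a b c' d e : ℕ), IsWeightedHomogeneous weight
      ((c : CoordRing k) * (X 0 ^ a * X 1 ^ b * X 2 ^ c' * X 3 ^ d * X 4 ^ e))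
      (a + 3 * b + 3 * c' + 3 * d + 2 * e) := by
    intro c a b c' d e
    have := (hC c).mul (((((hX 0 a).mul (hX 1 b)).mul (hX 2 c')).mul (hX 3 d)).mul (hX 4 e))
    convert this using 1
    simp [weight]
    ring
  simp only [separatingSet, Set.mem_insert_iff, Set.mem_singleton_iff] at hf
  rcases hf with rfl | rfl | rfl | rfl | rfl | rfl
  · exact ⟨1, by simpa [f₁] using hm 1 1 0 0 0 0⟩
  · refine ⟨6, ?_⟩
    convert (hm 2 3 0 1 0 0).add (hm (-1) 0 2 0 0 0) using 1
    simp [f₂]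
    ring
  · refine ⟨9, ?_⟩
    convert ((hm 3 6 0 0 1 0).add (hm (-3) 3 1 1 0 0)).add (hm 1 0 3 0 0 0) using 1
    simp [f₃]
    ring
  · refine ⟨3, ?_⟩
    convert (hm 1 1 0 0 0 1).add (hm (-1) 0 1 0 0 0) using 1
    simp [f₄]
    ring
  · refine ⟨8, ?_⟩
    convert (((hm 1 2 1 1 0 0).add (hm (-1) 0 2 0 0 1)).add (hm 2 3 0 1 0 1)).add
      (hm (-3) 5 0 0 1 0) using 1
    simp [f₅]
    ring
  · refine ⟨12, ?_⟩
    convert ((((hm (-18) 3 1 1 1 0).add (hm 9 6 0 0 2 0)).add (hm 8 3 0 3 0 0)).add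
      (hm 6 0 3 0 1 0)).add (hm (-3) 0 2 2 0 0) using 1
    simp [f₆]
    ring

variable [CharZero k]

lemma eval_eq_of_eval_separatingSet_eq {p q : Fin 5 → k}
    (h : ∀ f ∈ separatingSet k, eval p f = eval q f) {f : CoordRing k}
    (hf : f ∈ invariantRing k) : eval p f = eval q f := by
  have h1 := h (f₁ k) (by simp [separatingSet])
  have h2 := h (f₂ k) (by simp [separatingSet])
  have h3 := h (f₃ k) (by simp [separatingSet])
  have h4 := h (f₄ k) (by simp [separatingSet])
  have h5 := h (f₅ k) (by simp [separatingSet])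
  have h6 := h (f₆ k) (by simp [separatingSet])
  simp only [f₁, f₂, f₃, f₄, f₅, f₆, map_add, map_sub, map_mul, map_pow, map_neg, eval_X,
    map_ofNat] at h1 h2 h3 h4 h5 h6
  by_cases hx : p 0 = 0
  · rw [← h1] at h2 h3 h4 h5 h6
    rw [hx] at h1 h2 h3 h4 h5 h6
    have hs : q 1 = p 1 := by linear_combination h4
    rw [hs] at h2 h3 h4 h5 h6
    by_cases hps : p 1 = 0
    · have e : ∀ r : Fin 5 → k, r 0 = 0 → r 1 = 0 → eval r f = eval 0 f := by
        intro r hr0 hr1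
        rw [← eval_null hf (r 2) (r 3) (r 4)]
        congr 2
        funext i
        fin_cases i <;> simp [hr0, hr1]
      rw [e p hx hps, e q h1.symm (hs.trans hps)]
    · rw [← eval_translate hf ((q 2 - p 2) / p 1) p]
      congr 2
      -- At `x = 0`, `f₅` is `-s²v` and `f₆` is `6s³u - 3t²s²`, so they determine `v`, and `u` once
      -- `t` is known.
      have hv : q 4 = p 4 := by
        refine mul_left_cancel₀ (pow_ne_zero 2 hps) ?_
        linear_combination h5
      obtain ⟨a, ha⟩ : ∃ a, a = (q 2 - p 2) / p 1 := ⟨_, rfl⟩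
      have ht : q 2 = p 2 + a * p 1 := by rw [ha]; field_simp; ring
      have hu : q 3 = p 3 + a * p 2 + a ^ 2 / 2 * p 1 := by
        refine mul_left_cancel₀ (mul_ne_zero (by norm_num : (6 : k) ≠ 0) (pow_ne_zero 3 hps)) ?_
        rw [ht] at h6
        linear_combination -h6
      rw [← ha]
      funext i
      fin_cases i <;> simp [translate, hx, ← h1, hs, hv, ht, hu]
  · rw [← h1] at h2 h3 h4 h5 h6
    rw [← eval_translate hf ((q 1 - p 1) / p 0 ^ 3) p]
    congr 2
    -- With `a` matching `s`, the values of `f₂`, `f₃`, `f₄` determine `t`, `u`, `v` in turn, up to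
    -- powers of `x ≠ 0`.
    obtain ⟨a, ha⟩ : ∃ a, a = (q 1 - p 1) / p 0 ^ 3 := ⟨_, rfl⟩
    have hs : q 1 = p 1 + a * p 0 ^ 3 := by rw [ha]; field_simp; ring
    have ht : q 2 = p 2 + a * p 1 + a ^ 2 / 2 * p 0 ^ 3 := by
      refine mul_left_cancel₀ (mul_ne_zero (two_ne_zero (α := k)) (pow_ne_zero 3 hx)) ?_
      rw [hs] at h2
      linear_combination -h2
    have hu : q 3 = p 3 + a * p 2 + a ^ 2 / 2 * p 1 + a ^ 3 / 6 * p 0 ^ 3 := by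
      refine mul_left_cancel₀ (mul_ne_zero (three_ne_zero (α := k)) (pow_ne_zero 6 hx)) ?_
      rw [hs, ht] at h3
      linear_combination -h3
    have hv : q 4 = p 4 + a * p 0 ^ 2 := by
      refine mul_left_cancel₀ hx ?_
      rw [hs] at h4
      linear_combination -h4
    rw [← ha]
    funext i
    fin_cases i <;> simp [translate, ← h1, hs, hv, ht, hu]

end Separating

/-! ### Unbounded degree of `∂f/∂x` along the line -/

section NotFinitelyGenerated

variable (k) in
/-- The value of `∂f/∂x` on the line `x = s = t = u = 0`. -/
def normalX : CoordRing k →ₗ[k] Polynomial k :=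
  (restrictV k).toLinearMap ∘ₗ (pderiv 0).toLinearMap

lemma normalX_mul (f g : CoordRing k) :
    normalX k (f * g) = restrictV k f * normalX k g + restrictV k g * normalX k f := by
  simp [normalX]

lemma normalX_algebraMap (c : k) : normalX k (algebraMap k _ c) = 0 := by
  simp [normalX, MvPolynomial.algebraMap_eq]

lemma normalX_X (i : Fin 5) : normalX k (X i) = if i = 0 then 1 else 0 := by
  fin_cases i <;> simp [normalX, pderiv_X]

lemma normalX_X4_pow (n : ℕ) : normalX k (X 4 ^ n) = 0 := by
  simp [normalX, pderiv_X]

/-- Along the line `x = s = t = u = 0`, both `f` and `∂f/∂x` are constant. -/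
def ConstantToFirstOrder (f : CoordRing k) : Prop :=
  ∃ a b : k, restrictV k f = Polynomial.C a ∧ normalX k f = Polynomial.C b

lemma ConstantToFirstOrder.mul {f g : CoordRing k} (hf : ConstantToFirstOrder f)
    (hg : ConstantToFirstOrder g) : ConstantToFirstOrder (f * g) := by
  obtain ⟨a, b, ha, hb⟩ := hf
  obtain ⟨c, d, hc, hd⟩ := hg
  exact ⟨a * c, a * d + c * b, by simp [ha, hc], by simp [normalX_mul, ha, hb, hc, hd]⟩

lemma constantToFirstOrder_C (c : k) : ConstantToFirstOrder (C c) :=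
  ⟨c, 0, by simp [restrictV, Polynomial.algebraMap_eq],
    by rw [← MvPolynomial.algebraMap_eq, normalX_algebraMap, map_zero]⟩

lemma constantToFirstOrder_X {i : Fin 5} (hi : i ≠ 4) :
    ConstantToFirstOrder (X i : CoordRing k) := by
  refine ⟨0, if i = 0 then 1 else 0, ?_, ?_⟩
  · fin_cases i <;> simp_all [restrictV]
  · rw [normalX_X]; split_ifs <;> simp

lemma ConstantToFirstOrder.pow {f : CoordRing k} (hf : ConstantToFirstOrder f) (n : ℕ) :
    ConstantToFirstOrder (f ^ n) := by
  induction n with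
  | zero => simpa using constantToFirstOrder_C (1 : k)
  | succ n ih => rw [pow_succ]; exact ih.mul hf

lemma constantToFirstOrder_cubicMap (w : MvPolynomial (Fin 4) k) :
    ConstantToFirstOrder (cubicMap k w) := by
  induction w using MvPolynomial.induction_on with
  | C a => simpa [cubicMap, MvPolynomial.algebraMap_eq] using constantToFirstOrder_C a
  | add p q hp hq =>
    obtain ⟨a, b, ha, hb⟩ := hp
    obtain ⟨c, d, hc, hd⟩ := hq
    exact ⟨a + c, b + d, by simp [ha, hc], by simp [hb, hd]⟩
  | mul_X p i hp =>
    rw [map_mul]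
    refine hp.mul ?_
    have h0 := (constantToFirstOrder_X (k := k) (i := 0) (by decide)).pow 3
    have h1 := constantToFirstOrder_X (k := k) (i := 1) (by decide)
    have h2 := constantToFirstOrder_X (k := k) (i := 2) (by decide)
    have h3 := constantToFirstOrder_X (k := k) (i := 3) (by decide)
    fin_cases i <;> simpa [cubicMap]

lemma IsLadderElement.constantToFirstOrder {h : CoordRing k} (hh : IsLadderElement h) :
    ConstantToFirstOrder h := by
  obtain ⟨e, w, -, rfl, -⟩ := hh
  exact ((constantToFirstOrder_X (by decide)).pow e).mul (constantToFirstOrder_cubicMap w)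

variable [CharZero k]

omit [CharZero k] in
lemma D_dividedPow_zero : D k (((Nat.factorial 0 : k)⁻¹) • X 4 ^ 0) = 0 := by simp

lemma D_dividedPow_succ (n : ℕ) :
    D k (((n + 1).factorial : k)⁻¹ • X 4 ^ (n + 1)) =
      X 0 ^ 2 * ((n.factorial : k)⁻¹ • X 4 ^ n) := by
  have h1 : ((n : k) + 1) ≠ 0 := by exact_mod_cast n.succ_ne_zero
  have h2 : (n.factorial : k) ≠ 0 := by exact_mod_cast n.factorial_ne_zero
  rw [(D k).map_smul, Derivation.leibniz_pow, D_X4, Nat.add_sub_cancel, ← Nat.cast_smul_eq_nsmul k,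
    smul_smul, Nat.factorial_succ, smul_eq_mul, mul_smul_comm, mul_comm (X 4 ^ n)]
  congr 1
  push_cast
  field_simp

/-- For every `n` there is an invariant of the form `x vⁿ / n! + ⋯`. -/
lemma exists_invariant_coeff_normalX_ne_zero (n : ℕ) :
    ∃ F ∈ invariantRing k, (normalX k F).coeff (n + 1) ≠ 0 := by
  obtain ⟨h, h0, hD, hh⟩ := exists_ladder k
  refine ⟨∑ ij ∈ Finset.HasAntidiagonal.antidiagonal (n + 1),
    (-1 : k) ^ ij.1 • (h ij.1 * ((ij.2.factorial : k)⁻¹ • X 4 ^ ij.2)), ?_, ?_⟩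
  · rw [mem_invariantRing_iff_D_eq_zero, map_sum]
    simp only [(D k).map_smul ((-1) ^ _), Derivation.leibniz _ (h _), smul_add, Finset.sum_add_distrib]
    rw [Finset.Nat.sum_antidiagonal_succ', Finset.Nat.sum_antidiagonal_succ]
    simp only [D_dividedPow_succ, D_dividedPow_zero, hD, h0, D_X0, smul_zero, zero_add]
    rw [← Finset.sum_add_distrib]
    -- After the index shifts, `D hᵢ₊₁ = x² hᵢ` cancels `D (vʲ⁺¹ / (j+1)!) = x² vʲ / j!` through the
    -- alternating sign.
    refine Finset.sum_eq_zero fun ij _ => ?_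
    rw [pow_succ _ ij.1, mul_neg_one, neg_smul, smul_eq_mul, smul_eq_mul, ← sub_eq_add_neg, ← smul_sub]
    refine smul_eq_zero_of_right _ ?_
    ring
  · rw [map_sum, Polynomial.finsetSum_coeff, Finset.sum_eq_single (0, n + 1)]
    · have : ((n + 1).factorial : k) ≠ 0 := by exact_mod_cast (n + 1).factorial_ne_zero
      simpa [h0, normalX_mul, normalX_X, normalX_X4_pow, restrictV] using this
    -- The other terms contribute scalar multiples of `vʲ` with `j ≠ n + 1`, because `∂hᵢ/∂x` is
    -- constant on the line.
    · rintro ⟨i, j⟩ hij hne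
      obtain ⟨a, b, -, hb⟩ := (hh i).constantToFirstOrder
      have hj : n + 1 ≠ j := by
        rintro rfl
        rw [Finset.HasAntidiagonal.mem_antidiagonal] at hij
        exact hne (Prod.ext (by simpa using hij) rfl)
      simp [normalX_mul, normalX_X4_pow, hb, restrictV, Polynomial.coeff_X_pow, hj]
    · intro hn
      exact absurd (by simp) hn

lemma not_fg_invariantRing : ¬ (invariantRing k).FG := by
  rintro ⟨S, hS⟩
  have hdeg : ∀ f ∈ Algebra.adjoin k (S : Set (CoordRing k)),
      (normalX k f).natDegree ≤ S.sup fun s => (normalX k s).natDegree := by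
    intro f hf
    induction hf using Algebra.adjoin_induction with
    | mem s hs => exact Finset.le_sup (f := fun s => (normalX k s).natDegree) hs
    | algebraMap c => rw [normalX_algebraMap, Polynomial.natDegree_zero]; exact Nat.zero_le _
    | add f g _ _ hf hg =>
      rw [map_add]
      exact (Polynomial.natDegree_add_le _ _).trans (max_le hf hg)
    | mul f g hf' hg' hf hg =>
      rw [hS] at hf' hg'
      obtain ⟨a, ha⟩ := exists_restrictV_eq_C hf'
      obtain ⟨b, hb⟩ := exists_restrictV_eq_C hg'
      -- Invariants restrict to scalars, so a product does not raise the degree.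
      rw [normalX_mul, ha, hb]
      refine (Polynomial.natDegree_add_le _ _).trans (max_le ?_ ?_)
      · exact (Polynomial.natDegree_C_mul_le _ _).trans hg
      · exact (Polynomial.natDegree_C_mul_le _ _).trans hf
  obtain ⟨F, hF, hne⟩ := exists_invariant_coeff_normalX_ne_zero (k := k)
    (S.sup fun s => (normalX k s).natDegree)
  rw [← hS] at hF
  exact hne (Polynomial.coeff_eq_zero_of_natDegree_lt (Nat.lt_succ_of_le (hdeg F hF)))

end NotFinitelyGenerated

end

end DaigleFreudenburg

open DaigleFreudenburg in
theorem theorem2p1 (k : Type*) [Field k] [CharZero k] :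
    (∀ f ∈ separatingSet k, ∃ d : ℕ, MvPolynomial.IsWeightedHomogeneous weight f d) ∧
    (∀ f ∈ separatingSet k, ∀ a : k, gaAction k (Multiplicative.ofAdd a) f = f) ∧
    IsSeparatingSet (invariantRing k) (separatingSet k) ∧
    ¬ (invariantRing k).FG := by
  have hinv : ∀ f ∈ separatingSet k, f ∈ invariantRing k := fun f hf =>
    mem_invariantRing_iff_D_eq_zero.2 (D_eq_zero_of_mem_separatingSet hf)
  exact ⟨fun f hf => isWeightedHomogeneous_of_mem_separatingSet hf, hinv,
    ⟨hinv, fun p q h f hf => eval_eq_of_eval_separatingSet_eq h hf⟩, not_fg_invariantRing⟩
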